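/- All spaces are real. For normed spaces $X,Y$ let $\mathbb L(X,Y)$ be the space of bounded linear operators from $X$ to $Y$ with the operator norm, and for $A\in\mathbb L(X,Y)$ let $M_A=\{x\in X:\|x\|=1,\ \|Ax\|=\|A\|\}$ be its norm attainment set. Let $\epsilon>0$ and let $T,A\in\mathbb L(X,Y)$ with $\|T\|=\|A\|=1$. We say that $A$ is a uniform $\epsilon$-BPB approximation of $T$ if there exists $\delta>0$ such that for every $x_0\in X$ with $\|x_0\|=1$ and $\|Tx_0\|>1-\delta$ there exists $u_0\in M_A$ with $\|u_0-x_0\|<\epsilon$ and $\|T-A\|<\epsilon$; it is called non-trivial if $A\neq T$. The pair $(X,Y)$ has the non-trivial norm preserving uniform BPB approximation property if for every $T\in\mathbb L(X,Y)$ with $\|T\|=1$ that is not an isometry and every $\epsilon>0$ there is a non-trivial uniform $\epsilon$-BPB approximation $A_\epsilon$ of $T$ with $M_{A_\epsilon}=M_T$. Let $n\in\mathbb N$ and let $\ell_1^n$ be $\mathbb R^n$ with the norm $\|x\|=\sum_{i=1}^n|x_i|$. Let $T\in\mathbb L(\ell_1^n,\ell_1^n)$ with $\|T\|=1$. Then $T$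 is an isometry if and only if there exists $\epsilon_0>0$ such that for every $0<\epsilon<\epsilon_0$ the operator $T$ is the only uniform $\epsilon$-BPB approximation of $T$. Moreover, the pair $(\ell_1^n,\ell_1^n)$ has the non-trivial norm preserving uniform BPB approximation property. -/

import Mathlib

namespace BPB

variable {X Y : Type*} [NormedAddCommGroup X] [NormedSpace ℝ X]
  [NormedAddCommGroup Y] [NormedSpace ℝ Y]

/-- The norm attainment set `M_T` of a bounded linear operator. -/
def normAttainSet (T : X →L[ℝ] Y) : Set X :=
  {x | ‖x‖ = 1 ∧ ‖T x‖ = ‖T‖}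

/-- `A` is a uniform `ε`-BPB approximation of `T`; both operators have norm one. -/
def IsUniformApprox (ε : ℝ) (T A : X →L[ℝ] Y) : Prop :=
  ‖T‖ = 1 ∧ ‖A‖ = 1 ∧
    ∃ δ : ℝ, 0 < δ ∧ ∀ x₀ : X, ‖x₀‖ = 1 → 1 - δ < ‖T x₀‖ →
      ∃ u₀ ∈ normAttainSet A, ‖u₀ - x₀‖ < ε ∧ ‖T - A‖ < ε

/-- A uniform `ε`-BPB approximation of `T` that differs from `T`. -/
def IsNontrivialUniformApprox (ε : ℝ) (T A : X →L[ℝ] Y) : Prop :=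
  IsUniformApprox ε T A ∧ A ≠ T

/-- `T` is the only uniform `ε`-BPB approximation of `T`. -/
def IsOnlyUniformApprox (ε : ℝ) (T : X →L[ℝ] Y) : Prop :=
  ∀ A : X →L[ℝ] Y, IsUniformApprox ε T A ↔ A = T

variable (X Y) in
/-- The pair `(X, Y)` has the non-trivial norm preserving uniform BPB approximation property. -/
def HasNontrivialNormPreservingApprox : Prop :=
  ∀ T : X →L[ℝ] Y, ‖T‖ = 1 → ¬ Isometry T → ∀ ε : ℝ, 0 < ε →
    ∃ A : X →L[ℝ] Y, IsNontrivialUniformApprox ε T A ∧ normAttainSet T = normAttainSet A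

/-- The real space `ℓ₁ⁿ`: `ℝⁿ` with the norm `∑ |xᵢ|`. -/
abbrev ellOne (n : ℕ) : Type := PiLp 1 (fun _ : Fin n => ℝ)

end BPB

/-!
Let `Tᵢⱼ` be the matrix of an operator `T : ℓ₁(ι) → ℓ₁(κ)` of norm one. Then
`‖T x‖ ≤ ∑ⱼ ‖Tⱼ‖ |xⱼ| ≤ ‖x‖`, where `Tⱼ` are the columns, so `T` attains its norm at a unit
vector `x` exactly when `x` only charges columns of norm one and, within each row `i`, the terms
`Tᵢⱼ xⱼ` have compatible signs. Hence `M_T` only depends on which columns have norm one and on the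
signs of the entries. In finite dimensions, compactness makes every operator near `T` with the
same norm attainment set a uniform approximation of `T`, so `T` has non-trivial ones as soon as
one column can be moved a little without changing `M_T`. This is possible if a column has norm
less than one, if it has two nonzero entries (move it towards a signed basis vector of its
support), or if a row vanishes (move a column into that row). Otherwise `T eⱼ = ± e_{p j}` with
`p` surjective, and then `T` is rigid: it attains its norm at vectors with no zero coordinate,
with arbitrary signs prescribed on the fibres of `p`, and a sufficiently close approximation `A`
attains its norm at the same vectors, which forces the columns of `A` over different fibres to
have disjoint supports. If `|ι| ≤ |κ|`, then `p` is a bijection and `T` is an isometry.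
-/

namespace BPB

open SignType (sign)

section SignsOfReals

theorem abs_sum_eq_sum_abs_iff {α R : Type*} [CommRing R] [LinearOrder R] [IsStrictOrderedRing R]
    (s : Finset α) (a : α → R) :
    |∑ j ∈ s, a j| = ∑ j ∈ s, |a j| ↔ ∀ j ∈ s, ∀ k ∈ s, 0 ≤ a j * a k := by
  have hsum : 0 ≤ ∑ j ∈ s, |a j| := Finset.sum_nonneg fun _ _ => abs_nonneg _
  have hle (j k : α) : a j * a k ≤ |a j| * |a k| := (le_abs_self _).trans_eq (abs_mul _ _)
  rw [← sq_eq_sq₀ (abs_nonneg _) hsum, sq_abs, sq, sq, Finset.sum_mul_sum, Finset.sum_mul_sum,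
    Finset.sum_eq_sum_iff_of_le fun j _ => Finset.sum_le_sum fun k _ => hle j k]
  refine forall₂_congr fun j _ => ?_
  rw [Finset.sum_eq_sum_iff_of_le fun k _ => hle j k]
  exact forall₂_congr fun k _ => by rw [← abs_mul, eq_comm, abs_eq_self]

theorem abs_lineMap_of_mul_nonneg {a b η : ℝ} (hab : 0 ≤ a * b) (hη : η ∈ Set.Icc 0 1) :
    |AffineMap.lineMap a b η| = (1 - η) * |a| + η * |b| := by
  have hη' : 0 ≤ 1 - η := sub_nonneg.2 hη.2
  have hsigns : 0 ≤ (1 - η) * a ∧ 0 ≤ η * b ∨ (1 - η) * a ≤ 0 ∧ η * b ≤ 0 :=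
    (mul_nonneg_iff.1 hab).imp
      (fun h => ⟨mul_nonneg hη' h.1, mul_nonneg hη.1 h.2⟩)
      (fun h => ⟨mul_nonpos_of_nonneg_of_nonpos hη' h.1, mul_nonpos_of_nonneg_of_nonpos hη.1 h.2⟩)
  rw [AffineMap.lineMap_apply_module, smul_eq_mul, smul_eq_mul,
    (abs_add_eq_add_abs_iff _ _).2 hsigns, abs_mul, abs_mul, abs_of_nonneg hη', abs_of_nonneg hη.1]

theorem sign_lineMap_of_mul_nonneg {a b η : ℝ} (hab : 0 ≤ a * b) (hzero : a = 0 → b = 0)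
    (hη : η ∈ Set.Ioo 0 1) : sign (AffineMap.lineMap a b η) = sign a := by
  have hη' : 0 < 1 - η := sub_pos.2 hη.2
  rw [AffineMap.lineMap_apply_module, smul_eq_mul, smul_eq_mul]
  rcases lt_trichotomy a 0 with ha | rfl | ha
  · have hb : b ≤ 0 := nonpos_of_mul_nonneg_right hab ha
    rw [sign_neg ha, sign_neg (add_neg_of_neg_of_nonpos (mul_neg_of_pos_of_neg hη' ha)
      (mul_nonpos_of_nonneg_of_nonpos hη.1.le hb))]
  · simp [hzero rfl]
  · have hb : 0 ≤ b := nonneg_of_mul_nonneg_right hab ha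
    rw [sign_pos ha, sign_pos (add_pos_of_pos_of_nonneg (mul_pos hη' ha) (mul_nonneg hη.1.le hb))]

theorem sign_eq_of_abs_sub_lt {a b : ℝ} (h : |a - b| < |b|) : sign a = sign b := by
  rw [abs_lt] at h
  rcases lt_trichotomy b 0 with hb | rfl | hb
  · rw [abs_of_neg hb] at h
    rw [sign_neg hb, sign_neg (by linarith)]
  · simp only [abs_zero, neg_zero] at h
    exact absurd (h.1.trans h.2) (lt_irrefl 0)
  · rw [abs_of_pos hb] at h
    rw [sign_pos hb, sign_pos (by linarith)]

theorem eq_of_abs_sub_lt_of_abs_eq {a b : ℝ} (h : |a - b| < |b|) (hab : |a| = |b|) : a = b := by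
  rw [← sign_mul_abs a, sign_eq_of_abs_sub_lt h, hab, sign_mul_abs]

end SignsOfReals

section UniformApproximation

theorem exists_forall_dist_lt_of_isCompact {E : Type*} [PseudoMetricSpace E] {K : Set E}
    (hK : IsCompact K) {f : E → ℝ} (hf : ContinuousOn f K) {M : ℝ} (hM : ∀ x ∈ K, f x ≤ M)
    {ε : ℝ} (hε : 0 < ε) :
    ∃ δ > 0, ∀ x ∈ K, M - δ < f x → ∃ u ∈ K, f u = M ∧ dist x u < ε := by
  set S : Set E := {u | u ∈ K ∧ f u = M}
  have hlt : ∀ x ∈ K \ Metric.thickening ε S, f x < M := fun x hx =>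
    (hM x hx.1).lt_of_ne fun hfx => hx.2 (Metric.self_subset_thickening hε S ⟨hx.1, hfx⟩)
  obtain ⟨δ, hδ, hδM⟩ := (hK.diff Metric.isOpen_thickening).exists_forall_le'
    ((continuousOn_const.sub hf).mono Set.sdiff_subset) fun x hx => sub_pos.2 (hlt x hx)
  refine ⟨δ, hδ, fun x hx hfx => ?_⟩
  have hnear : x ∈ Metric.thickening ε S := by
    by_contra hfar
    have hle : δ ≤ M - f x := hδM x ⟨hx, hfar⟩
    linarith
  obtain ⟨u, ⟨huK, hfu⟩, hxu⟩ := Metric.mem_thickening_iff.1 hnear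
  exact ⟨u, huK, hfu, hxu⟩

variable {X Y : Type*} [NormedAddCommGroup X] [NormedSpace ℝ X]
  [NormedAddCommGroup Y] [NormedSpace ℝ Y] {T A : X →L[ℝ] Y} {ε : ℝ}

theorem exists_forall_near_normAttainSet [FiniteDimensional ℝ X] (T : X →L[ℝ] Y) (hε : 0 < ε) :
    ∃ δ > 0, ∀ x : X, ‖x‖ = 1 → ‖T‖ - δ < ‖T x‖ → ∃ u ∈ normAttainSet T, ‖u - x‖ < ε := by
  have : ProperSpace X := FiniteDimensional.proper ℝ X
  obtain ⟨δ, hδ, h⟩ := exists_forall_dist_lt_of_isCompact (isCompact_sphere (0 : X) 1)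
    (f := fun x => ‖T x‖) (by fun_prop)
    (fun x hx => T.unit_le_opNorm x (mem_sphere_zero_iff_norm.1 hx).le) hε
  refine ⟨δ, hδ, fun x hx hTx => ?_⟩
  obtain ⟨u, hu, hTu, hxu⟩ := h x (mem_sphere_zero_iff_norm.2 hx) hTx
  exact ⟨u, ⟨mem_sphere_zero_iff_norm.1 hu, hTu⟩, by rwa [← dist_eq_norm, dist_comm]⟩

theorem isUniformApprox_of_normAttainSet_eq [FiniteDimensional ℝ X] (hT : ‖T‖ = 1) (hA : ‖A‖ = 1)
    (hM : normAttainSet T = normAttainSet A) (hTA : ‖T - A‖ < ε) : IsUniformApprox ε T A := by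
  obtain ⟨δ, hδ, h⟩ := exists_forall_near_normAttainSet T ((norm_nonneg _).trans_lt hTA)
  refine ⟨hT, hA, δ, hδ, fun x hx hTx => ?_⟩
  obtain ⟨u, hu, hux⟩ := h x hx (hT ▸ hTx)
  exact ⟨u, hM ▸ hu, hux, hTA⟩

theorem IsUniformApprox.exists_near {x : X} (h : IsUniformApprox ε T A) (hx : x ∈ normAttainSet T) :
    ∃ u ∈ normAttainSet A, ‖u - x‖ < ε ∧ ‖T - A‖ < ε := by
  obtain ⟨hT, -, δ, hδ, hnear⟩ := h
  exact hnear x hx.1 (by rw [hx.2, hT]; linarith)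

/-- `T` has non-trivial norm preserving uniform `ε`-BPB approximations for every `ε > 0`. This is
what `HasNontrivialNormPreservingApprox` asks of every operator of norm one that is not an
isometry. -/
def IsNormPreservinglyApproximable (T : X →L[ℝ] Y) : Prop :=
  ∀ ε : ℝ, 0 < ε →
    ∃ A : X →L[ℝ] Y, IsNontrivialUniformApprox ε T A ∧ normAttainSet T = normAttainSet A

theorem not_isNormPreservinglyApproximable_of_isOnlyUniformApprox {ε₀ : ℝ} (hε₀ : 0 < ε₀)
    (h : ∀ ε : ℝ, 0 < ε → ε < ε₀ → IsOnlyUniformApprox ε T) :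
    ¬ IsNormPreservinglyApproximable T := fun happ => by
  obtain ⟨A, ⟨hA, hne⟩, -⟩ := happ (ε₀ / 2) (half_pos hε₀)
  exact hne ((h _ (half_pos hε₀) (half_lt_self hε₀) A).1 hA)

end UniformApproximation

/-- The space `ℓ₁(ι)` over an arbitrary finite index type; `ellOneOn (Fin n)` is `ellOne n`. -/
abbrev ellOneOn (ι : Type*) : Type _ := PiLp 1 (fun _ : ι => ℝ)

variable {ι κ : Type*}

section Coordinates

theorem exists_apply_ne_zero {x : ellOneOn ι} (hx : x ≠ 0) : ∃ i, x i ≠ 0 := by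
  contrapose! hx
  ext i
  exact hx i

theorem lineMap_apply_coord (c w : ellOneOn ι) (η : ℝ) (i : ι) :
    (AffineMap.lineMap c w η : ellOneOn ι) i = AffineMap.lineMap (c i) (w i) η := by
  simp [AffineMap.lineMap_apply_module]

variable [Fintype ι]

theorem finrank_ellOneOn : Module.finrank ℝ (ellOneOn ι) = Fintype.card ι := by
  rw [(WithLp.linearEquiv 1 ℝ (ι → ℝ)).finrank_eq, Module.finrank_fintype_fun_eq_card]

theorem norm_ellOneOn (x : ellOneOn ι) : ‖x‖ = ∑ i, |x i| :=
  PiLp.norm_eq_of_L1 x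

theorem norm_eq_abs_of_forall_ne {x : ellOneOn ι} {i : ι} (h : ∀ j, j ≠ i → x j = 0) :
    ‖x‖ = |x i| := by
  rw [norm_ellOneOn, Finset.sum_eq_single i (fun j _ hj => by rw [h j hj, abs_zero]) (by simp)]

theorem norm_lineMap_of_mul_nonneg {c w : ellOneOn ι} (h : ∀ i, 0 ≤ c i * w i) {η : ℝ}
    (hη : η ∈ Set.Icc 0 1) :
    ‖(AffineMap.lineMap c w η : ellOneOn ι)‖ = (1 - η) * ‖c‖ + η * ‖w‖ := by
  simp_rw [norm_ellOneOn, lineMap_apply_coord, abs_lineMap_of_mul_nonneg (h _) hη,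
    Finset.sum_add_distrib, Finset.mul_sum]

end Coordinates

section Columns

variable {Y : Type*} [NormedAddCommGroup Y] [NormedSpace ℝ Y]

theorem nonempty_of_ne_zero {T : ellOneOn ι →L[ℝ] Y} (hT : T ≠ 0) : Nonempty ι := by
  by_contra hempty
  have := not_nonempty_iff.1 hempty
  exact hT (ContinuousLinearMap.ext fun x => by rw [Subsingleton.elim x 0, map_zero, map_zero])

variable [DecidableEq ι]

/-- The `j`-th column of an operator on `ℓ₁(ι)`, that is, its value at the `j`-th basis vector. For
operators into `ℓ₁(κ)` the matrix entry in row `i` and column `j` is `col T j i`: the column index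
comes first. -/
noncomputable def col (T : ellOneOn ι →L[ℝ] Y) (j : ι) : Y :=
  T (PiLp.single 1 j 1)

/-- The operator obtained from `T` by replacing its `j`-th column by `c`. -/
noncomputable def replaceCol (T : ellOneOn ι →L[ℝ] Y) (j : ι) (c : Y) : ellOneOn ι →L[ℝ] Y :=
  T + (PiLp.proj (𝕜 := ℝ) 1 (fun _ : ι => ℝ) j).smulRight (c - col T j)

theorem replaceCol_apply (T : ellOneOn ι →L[ℝ] Y) (j : ι) (c : Y) (x : ellOneOn ι) :
    replaceCol T j c x = T x + x j • (c - col T j) :=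
  rfl

theorem col_replaceCol_same (T : ellOneOn ι →L[ℝ] Y) (j : ι) (c : Y) :
    col (replaceCol T j c) j = c := by
  rw [col, replaceCol_apply, PiLp.single_eq_same, one_smul, ← col, add_sub_cancel]

theorem col_replaceCol_of_ne (T : ellOneOn ι →L[ℝ] Y) {j k : ι} (hk : k ≠ j) (c : Y) :
    col (replaceCol T j c) k = col T k := by
  rw [col, replaceCol_apply, PiLp.single_eq_of_ne' _ hk, zero_smul, add_zero, col]

variable [Fintype ι]

theorem apply_eq_sum_smul_col (T : ellOneOn ι →L[ℝ] Y) (x : ellOneOn ι) :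
    T x = ∑ j, x j • col T j := by
  have hx : ∑ j, x j • PiLp.single 1 j (1 : ℝ) = x := by
    ext i
    simp [Pi.single_apply]
  conv_lhs => rw [← hx]
  simp only [map_sum, map_smul, col]

theorem norm_col_le (T : ellOneOn ι →L[ℝ] Y) (j : ι) : ‖col T j‖ ≤ ‖T‖ :=
  T.unit_le_opNorm _ (by simp [PiLp.norm_single])

theorem norm_apply_le_sum_norm_col (T : ellOneOn ι →L[ℝ] Y) (x : ellOneOn ι) :
    ‖T x‖ ≤ ∑ j, ‖col T j‖ * |x j| := by
  rw [apply_eq_sum_smul_col]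
  exact norm_sum_le_of_le _ fun j _ => by rw [norm_smul, Real.norm_eq_abs, mul_comm]

theorem opNorm_le_of_norm_col_le {T : ellOneOn ι →L[ℝ] Y} {C : ℝ} (hC : 0 ≤ C)
    (h : ∀ j, ‖col T j‖ ≤ C) : ‖T‖ ≤ C := by
  refine T.opNorm_le_bound hC fun x => (norm_apply_le_sum_norm_col T x).trans ?_
  rw [norm_ellOneOn, Finset.mul_sum]
  exact Finset.sum_le_sum fun j _ => mul_le_mul_of_nonneg_right (h j) (abs_nonneg _)

theorem exists_norm_col_eq_opNorm [Nonempty ι] (T : ellOneOn ι →L[ℝ] Y) :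
    ∃ j, ‖col T j‖ = ‖T‖ := by
  obtain ⟨j, hj⟩ := Finite.exists_max fun j => ‖col T j‖
  exact ⟨j, (norm_col_le T j).antisymm (opNorm_le_of_norm_col_le (norm_nonneg _) hj)⟩

theorem sum_norm_col_mul_abs_le (T : ellOneOn ι →L[ℝ] Y) (x : ellOneOn ι) :
    ∑ j, ‖col T j‖ * |x j| ≤ ‖T‖ * ‖x‖ := by
  rw [norm_ellOneOn, Finset.mul_sum]
  exact Finset.sum_le_sum fun j _ => mul_le_mul_of_nonneg_right (norm_col_le T j) (abs_nonneg _)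

theorem sum_norm_col_mul_abs_eq_iff (T : ellOneOn ι →L[ℝ] Y) (x : ellOneOn ι) :
    ∑ j, ‖col T j‖ * |x j| = ‖T‖ * ‖x‖ ↔ ∀ j, x j ≠ 0 → ‖col T j‖ = ‖T‖ := by
  rw [norm_ellOneOn, Finset.mul_sum, Finset.sum_eq_sum_iff_of_le fun j _ =>
    mul_le_mul_of_nonneg_right (norm_col_le T j) (abs_nonneg _)]
  simp only [Finset.mem_univ, true_imp_iff, mul_eq_mul_right_iff, abs_eq_zero, or_iff_not_imp_right,
    ne_eq]

theorem norm_sub_replaceCol_le (T : ellOneOn ι →L[ℝ] Y) (j : ι) (c : Y) :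
    ‖T - replaceCol T j c‖ ≤ ‖c - col T j‖ := by
  refine ContinuousLinearMap.opNorm_le_bound _ (norm_nonneg _) fun x => ?_
  rw [sub_apply, replaceCol_apply, sub_add_cancel_left, norm_neg, norm_smul,
    mul_comm]
  exact mul_le_mul_of_nonneg_left (PiLp.norm_apply_le x j) (norm_nonneg _)

theorem norm_col_replaceCol_eq_iff {T : ellOneOn ι →L[ℝ] Y} {j : ι} {c : Y}
    (hc : ‖c‖ = ‖T‖ ↔ ‖col T j‖ = ‖T‖) (k : ι) :
    ‖col (replaceCol T j c) k‖ = ‖T‖ ↔ ‖col T k‖ = ‖T‖ := by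
  rcases eq_or_ne k j with rfl | hk
  · rw [col_replaceCol_same, hc]
  · rw [col_replaceCol_of_ne T hk]

theorem opNorm_replaceCol {T : ellOneOn ι →L[ℝ] Y} {j : ι} {c : Y} (hle : ‖c‖ ≤ ‖T‖)
    (hc : ‖c‖ = ‖T‖ ↔ ‖col T j‖ = ‖T‖) : ‖replaceCol T j c‖ = ‖T‖ := by
  refine le_antisymm (opNorm_le_of_norm_col_le (norm_nonneg _) fun k => ?_) ?_
  · rcases eq_or_ne k j with rfl | hk
    · rwa [col_replaceCol_same]
    · rw [col_replaceCol_of_ne T hk]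
      exact norm_col_le T k
  · have : Nonempty ι := ⟨j⟩
    obtain ⟨k, hk⟩ := exists_norm_col_eq_opNorm T
    rw [← (norm_col_replaceCol_eq_iff hc k).2 hk]
    exact norm_col_le _ k

end Columns

section Cancellation

variable [Fintype κ] [DecidableEq ι] {T : ellOneOn ι →L[ℝ] ellOneOn κ} {x y : ellOneOn ι}

/-- The terms `Tᵢⱼ xⱼ` whose sum is the `i`-th coordinate of `T x` never have opposite signs. -/
def NoCancellation (T : ellOneOn ι →L[ℝ] ellOneOn κ) (x : ellOneOn ι) : Prop :=
  ∀ i j k, 0 ≤ (col T j i * x j) * (col T k i * x k)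

theorem NoCancellation.of_sign_eq (h : NoCancellation T y) (hxy : ∀ j, sign (x j) = sign (y j)) :
    NoCancellation T x := by
  intro i j k
  have hijk := h i j k
  rw [← sign_nonneg_iff] at hijk ⊢
  simpa only [sign_mul, hxy] using hijk

theorem forall_noCancellation_iff :
    (∀ x, NoCancellation T x) ↔ ∀ i j k, j ≠ k → col T j i * col T k i = 0 := by
  refine ⟨fun h i j k hjk => ?_, fun h x i j k => ?_⟩
  · have hplus := h (PiLp.single 1 j 1 + PiLp.single 1 k 1) i j k
    have hminus := h (PiLp.single 1 j 1 - PiLp.single 1 k 1) i j k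
    simp only [PiLp.add_apply, PiLp.sub_apply, PiLp.single_eq_same, PiLp.single_eq_of_ne _ hjk,
      PiLp.single_eq_of_ne _ hjk.symm, add_zero, zero_add, sub_zero, zero_sub, mul_one, mul_neg,
      Left.nonneg_neg_iff] at hplus hminus
    exact hminus.antisymm hplus
  · rcases eq_or_ne j k with rfl | hjk
    · exact mul_self_nonneg _
    · rw [mul_mul_mul_comm, h i j k hjk, zero_mul]

theorem noCancellation_replaceCol_iff {j : ι} {c : ellOneOn κ}
    (hsign : ∀ i, sign (c i) = sign (col T j i) ∨ ∀ k ≠ j, col T k i = 0) :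
    NoCancellation (replaceCol T j c) x ↔ NoCancellation T x := by
  refine forall_congr' fun i => ?_
  rcases hsign i with hi | hi
  · have hrow (k : ι) : sign (col (replaceCol T j c) k i) = sign (col T k i) := by
      rcases eq_or_ne k j with rfl | hk
      · rw [col_replaceCol_same, hi]
      · rw [col_replaceCol_of_ne T hk]
    refine forall₂_congr fun k l => ?_
    rw [← sign_nonneg_iff, ← sign_nonneg_iff (a := col T k i * x k * (col T l i * x l))]
    simp only [sign_mul, hrow]
  · have hsupported {B : ellOneOn ι →L[ℝ] ellOneOn κ} (hB : ∀ k ≠ j, col B k i = 0) (k l : ι) :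
        0 ≤ (col B k i * x k) * (col B l i * x l) := by
      rcases eq_or_ne k l with rfl | hkl
      · exact mul_self_nonneg _
      · rcases hkl.ne_or_ne j with hk | hl
        · simp [hB k hk]
        · simp [hB l hl]
    refine iff_of_true (hsupported fun k hk => ?_) (hsupported hi)
    rw [col_replaceCol_of_ne T hk, hi k hk]

end Cancellation

section NormAttainment

variable [Fintype ι] [Fintype κ]

theorem norm_apply_eq_sum_norm_col_iff [DecidableEq ι] (T : ellOneOn ι →L[ℝ] ellOneOn κ)
    (x : ellOneOn ι) :
    ‖T x‖ = ∑ j, ‖col T j‖ * |x j| ↔ NoCancellation T x := by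
  have hcoord (i : κ) : T x i = ∑ j, col T j i * x j := by
    rw [apply_eq_sum_smul_col]
    simp [mul_comm]
  have hswap : ∑ j, ‖col T j‖ * |x j| = ∑ i, ∑ j, |col T j i * x j| := by
    rw [Finset.sum_comm]
    simp_rw [norm_ellOneOn, Finset.sum_mul, abs_mul]
  rw [norm_ellOneOn, hswap]
  simp_rw [hcoord]
  rw [Finset.sum_eq_sum_iff_of_le fun i _ => Finset.abs_sum_le_sum_abs _ _]
  simp only [Finset.mem_univ, true_imp_iff, abs_sum_eq_sum_abs_iff, NoCancellation]

theorem mem_normAttainSet_iff [DecidableEq ι] (T : ellOneOn ι →L[ℝ] ellOneOn κ) (x : ellOneOn ι) :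
    x ∈ normAttainSet T ↔
      ‖x‖ = 1 ∧ (∀ j, x j ≠ 0 → ‖col T j‖ = ‖T‖) ∧ NoCancellation T x := by
  rw [← sum_norm_col_mul_abs_eq_iff, ← norm_apply_eq_sum_norm_col_iff]
  refine and_congr_right fun hx => ?_
  have hle := norm_apply_le_sum_norm_col T x
  have hle' := sum_norm_col_mul_abs_le T x
  rw [hx, mul_one] at hle' ⊢
  constructor
  · intro h
    constructor <;> linarith
  · rintro ⟨h, h'⟩
    exact h'.trans h

variable {T A : ellOneOn ι →L[ℝ] ellOneOn κ} {x y : ellOneOn ι}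

theorem mem_normAttainSet_of_sign_eq (hy : y ∈ normAttainSet T) (hx : ‖x‖ = 1)
    (hxy : ∀ j, sign (x j) = sign (y j)) : x ∈ normAttainSet T := by
  classical
  obtain ⟨-, hcol, hno⟩ := (mem_normAttainSet_iff T y).1 hy
  refine (mem_normAttainSet_iff T x).2 ⟨hx, fun j hxj => hcol j ?_, hno.of_sign_eq hxy⟩
  rwa [← sign_ne_zero, ← hxy, sign_ne_zero]

theorem IsUniformApprox.mem_normAttainSet {ε : ℝ} (h : IsUniformApprox ε T A)
    (hx : x ∈ normAttainSet T) (hε : ∀ j, ε ≤ |x j|) : x ∈ normAttainSet A := by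
  obtain ⟨u, hu, hux, -⟩ := h.exists_near hx
  refine mem_normAttainSet_of_sign_eq hu hx.1 fun j => (sign_eq_of_abs_sub_lt ?_).symm
  exact ((PiLp.norm_apply_le (u - x) j).trans_lt hux).trans_le (hε j)

theorem normAttainSet_replaceCol [DecidableEq ι] {j : ι} {c : ellOneOn κ} (hle : ‖c‖ ≤ ‖T‖)
    (hc : ‖c‖ = ‖T‖ ↔ ‖col T j‖ = ‖T‖)
    (hsign : ‖col T j‖ = ‖T‖ → ∀ i, sign (c i) = sign (col T j i) ∨ ∀ k ≠ j, col T k i = 0) :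
    normAttainSet (replaceCol T j c) = normAttainSet T := by
  ext x
  by_cases hxj : x j = 0
  · simp only [normAttainSet, Set.mem_ofPred_eq, replaceCol_apply, hxj, zero_smul, add_zero,
      opNorm_replaceCol hle hc]
  · rw [mem_normAttainSet_iff, mem_normAttainSet_iff, opNorm_replaceCol hle hc]
    simp only [norm_col_replaceCol_eq_iff hc]
    exact and_congr_right fun _ => and_congr_right fun hcol =>
      noCancellation_replaceCol_iff (hsign (hcol j hxj))

end NormAttainment

section Perturbation

variable [Fintype ι] [Fintype κ] [DecidableEq ι] {T : ellOneOn ι →L[ℝ] ellOneOn κ} {j : ι}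

theorem isNontrivialUniformApprox_replaceCol (hT : ‖T‖ = 1) {ε : ℝ} {c : ellOneOn κ}
    (hne : c ≠ col T j) (hε : ‖c - col T j‖ < ε) (hle : ‖c‖ ≤ 1)
    (hc : ‖c‖ = 1 ↔ ‖col T j‖ = 1)
    (hM : normAttainSet (replaceCol T j c) = normAttainSet T) :
    IsNontrivialUniformApprox ε T (replaceCol T j c) := by
  refine ⟨isUniformApprox_of_normAttainSet_eq hT ?_ hM.symm
    ((norm_sub_replaceCol_le T j c).trans_lt hε), fun h => hne ?_⟩
  · rw [← hT] at hle hc ⊢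
    exact opNorm_replaceCol hle hc
  · rw [← col_replaceCol_same T j c, h]

theorem isNormPreservinglyApproximable_of_col_lineMap (hT : ‖T‖ = 1) {w : ellOneOn κ}
    (hw : w ≠ col T j)
    (hnorm : ∀ η ∈ Set.Ioo (0 : ℝ) 1, ‖(AffineMap.lineMap (col T j) w η : ellOneOn κ)‖ ≤ 1 ∧
      (‖(AffineMap.lineMap (col T j) w η : ellOneOn κ)‖ = 1 ↔ ‖col T j‖ = 1))
    (hsign : ‖col T j‖ = 1 → ∀ η ∈ Set.Ioo (0 : ℝ) 1, ∀ i,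
      sign ((AffineMap.lineMap (col T j) w η : ellOneOn κ) i) = sign (col T j i) ∨
        ∀ k ≠ j, col T k i = 0) :
    IsNormPreservinglyApproximable T := by
  intro ε hε
  obtain ⟨b, hb, hbε⟩ := exists_pos_mul_lt hε (dist (col T j) w)
  obtain ⟨η, hη, hηb⟩ := exists_between (lt_min hb one_pos)
  rw [lt_min_iff] at hηb
  have hη01 : η ∈ Set.Ioo (0 : ℝ) 1 := ⟨hη, hηb.2⟩
  obtain ⟨hle, hc⟩ := hnorm η hη01
  have hM := normAttainSet_replaceCol (T := T) (by rwa [hT]) (by rwa [hT])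
    (by rw [hT]; exact fun h => hsign h η hη01)
  refine ⟨_, isNontrivialUniformApprox_replaceCol hT ?_ ?_ hle hc hM, hM.symm⟩
  · rw [Ne, AffineMap.lineMap_eq_left_iff]
    exact not_or.2 ⟨hw.symm, hη.ne'⟩
  · rw [← dist_eq_norm, dist_lineMap_left, Real.norm_of_nonneg hη.le, mul_comm]
    exact (mul_le_mul_of_nonneg_left hηb.1.le dist_nonneg).trans_lt hbε

theorem isNormPreservinglyApproximable_of_norm_col_ne_one (hT : ‖T‖ = 1) (hj : ‖col T j‖ ≠ 1) :
    IsNormPreservinglyApproximable T := by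
  have : Nonempty ι := ⟨j⟩
  obtain ⟨k, hk⟩ := exists_norm_col_eq_opNorm T
  rw [hT] at hk
  have hlt : ‖col T j‖ < 1 := (hT ▸ norm_col_le T j).lt_of_ne hj
  refine isNormPreservinglyApproximable_of_col_lineMap hT (j := j) (w := col T k)
    (fun h => hj (h ▸ hk)) (fun η hη => ?_) fun h => absurd h hj
  have hlt' : ‖(AffineMap.lineMap (col T j) (col T k) η : ellOneOn κ)‖ < 1 := by
    rw [AffineMap.lineMap_apply_module]
    refine (norm_add_le _ _).trans_lt ?_
    rw [norm_smul, norm_smul, Real.norm_of_nonneg (sub_nonneg.2 hη.2.le),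
      Real.norm_of_nonneg hη.1.le, hk]
    linarith [mul_lt_mul_of_pos_left hlt (sub_pos.2 hη.2)]
  exact ⟨hlt'.le, iff_of_false hlt'.ne hj⟩

theorem isNormPreservinglyApproximable_of_unit_vector (hT : ‖T‖ = 1) (hj : ‖col T j‖ = 1)
    {w : ellOneOn κ} (hw : ‖w‖ = 1) (hne : w ≠ col T j) (hnonneg : ∀ i, 0 ≤ col T j i * w i)
    (hrow : ∀ i, (col T j i = 0 → w i = 0) ∨ ∀ k ≠ j, col T k i = 0) :
    IsNormPreservinglyApproximable T := by
  refine isNormPreservinglyApproximable_of_col_lineMap hT hne (fun η hη => ?_)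
    fun _ η hη i => (hrow i).imp_left fun hzero => ?_
  · have hone : ‖(AffineMap.lineMap (col T j) w η : ellOneOn κ)‖ = 1 := by
      rw [norm_lineMap_of_mul_nonneg hnonneg (Set.Ioo_subset_Icc_self hη), hj, hw]
      ring
    exact ⟨hone.le, iff_of_true hone hj⟩
  · rw [lineMap_apply_coord]
    exact sign_lineMap_of_mul_nonneg (hnonneg i) hzero hη

theorem isNormPreservinglyApproximable_of_two_entries_ne_zero (hT : ‖T‖ = 1) (hj : ‖col T j‖ = 1)
    {i l : κ} (hil : i ≠ l) (hi : col T j i ≠ 0) (hl : col T j l ≠ 0) :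
    IsNormPreservinglyApproximable T := by
  classical
  set w : ellOneOn κ := PiLp.single 1 l (sign (col T j l) : ℝ) with hw
  have hwl : w l = sign (col T j l) := PiLp.single_eq_same ..
  have hw_ne (k : κ) (hk : k ≠ l) : w k = 0 := PiLp.single_eq_of_ne _ hk _
  have hw_norm : ‖w‖ = 1 := by
    rw [hw, PiLp.norm_single]
    rcases hl.lt_or_gt with h | h <;> simp [h]
  refine isNormPreservinglyApproximable_of_unit_vector hT hj hw_norm
    (fun h => hi (h ▸ hw_ne i hil)) (fun k => ?_) fun k => Or.inl fun hk => ?_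
  · rcases eq_or_ne k l with rfl | hkl
    · rw [hwl, self_mul_sign]
      exact abs_nonneg _
    · rw [hw_ne k hkl, mul_zero]
  · exact hw_ne k fun hkl => hl (hkl ▸ hk)

theorem isNormPreservinglyApproximable_of_row_eq_zero (hT : ‖T‖ = 1) (hj : ‖col T j‖ = 1) {l : κ}
    (hl : ∀ k, col T k l = 0) : IsNormPreservinglyApproximable T := by
  classical
  set w : ellOneOn κ := PiLp.single 1 l 1 with hw
  have hwl : w l = 1 := PiLp.single_eq_same ..
  have hw_ne (k : κ) (hk : k ≠ l) : w k = 0 := PiLp.single_eq_of_ne _ hk _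
  have hw_norm : ‖w‖ = 1 := by rw [hw, PiLp.norm_single, norm_one]
  refine isNormPreservinglyApproximable_of_unit_vector hT hj hw_norm
    (fun h => one_ne_zero (hwl.symm.trans (h ▸ hl j))) (fun i => ?_) fun i => ?_
  · rcases eq_or_ne i l with rfl | hi
    · rw [hl j, zero_mul]
    · rw [hw_ne i hi, mul_zero]
  · rcases eq_or_ne i l with rfl | hi
    · exact Or.inr fun k _ => hl k
    · exact Or.inl fun _ => hw_ne i hi

end Perturbation

section MonomialOperators

variable [Fintype κ] [DecidableEq ι] {T A : ellOneOn ι →L[ℝ] ellOneOn κ} {p : ι → κ} {ε : ℝ}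

/-- `T eⱼ = ± e_{p j}` for every `j`, stated through the columns of `T`. For a bijection `p` these
are the signed permutation matrices. -/
structure IsMonomial (T : ellOneOn ι →L[ℝ] ellOneOn κ) (p : ι → κ) : Prop where
  norm_col : ∀ j, ‖col T j‖ = 1
  col_eq_zero : ∀ j i, i ≠ p j → col T j i = 0

theorem IsMonomial.abs_col_eq_one (h : IsMonomial T p) (j : ι) : |col T j (p j)| = 1 :=
  (norm_eq_abs_of_forall_ne (h.col_eq_zero j)).symm.trans (h.norm_col j)

variable [Fintype ι]

theorem IsMonomial.opNorm_eq_one [Nonempty ι] (h : IsMonomial T p) : ‖T‖ = 1 := by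
  obtain ⟨j, hj⟩ := exists_norm_col_eq_opNorm T
  rw [← hj, h.norm_col]

theorem exists_surjective_isMonomial (hT : ‖T‖ = 1) (h : ¬ IsNormPreservinglyApproximable T) :
    ∃ p : ι → κ, p.Surjective ∧ IsMonomial T p := by
  have hone (j : ι) : ‖col T j‖ = 1 := by
    by_contra hj
    exact h (isNormPreservinglyApproximable_of_norm_col_ne_one hT hj)
  choose p hp using fun j =>
    exists_apply_ne_zero (norm_ne_zero_iff.1 ((hone j).trans_ne one_ne_zero))
  have hmono : IsMonomial T p := ⟨hone, fun j i hi => by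
    by_contra hne
    exact h (isNormPreservinglyApproximable_of_two_entries_ne_zero hT (hone j) hi hne (hp j))⟩
  refine ⟨p, fun l => ?_, hmono⟩
  by_contra! hl
  obtain ⟨j⟩ := nonempty_of_ne_zero (norm_pos_iff.1 (hT ▸ one_pos))
  exact h (isNormPreservinglyApproximable_of_row_eq_zero hT (hone j)
    fun k => hmono.col_eq_zero k l (hl k).symm)

/-- For an operator `T` that is monomial over `p` and signs `σ`, the unit vector with all
coordinates of modulus `1 / |ι|` that `T` maps, without cancellation, to a vector with signs `σ` on
the range of `p`. -/
noncomputable def alignedVec (T : ellOneOn ι →L[ℝ] ellOneOn κ) (p : ι → κ) (σ : κ → ℝ) :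
    ellOneOn ι :=
  WithLp.toLp 1 fun j => σ (p j) * col T j (p j) / Fintype.card ι

theorem IsMonomial.abs_alignedVec (h : IsMonomial T p) {σ : κ → ℝ} (hσ : ∀ i, |σ i| = 1) (j : ι) :
    |alignedVec T p σ j| = 1 / Fintype.card ι := by
  rw [alignedVec, PiLp.toLp_apply, abs_div, abs_mul, hσ, h.abs_col_eq_one, one_mul, Nat.abs_cast]

theorem IsMonomial.alignedVec_mem_normAttainSet [Nonempty ι] (h : IsMonomial T p) {σ : κ → ℝ}
    (hσ : ∀ i, |σ i| = 1) : alignedVec T p σ ∈ normAttainSet T := by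
  refine (mem_normAttainSet_iff T _).2
    ⟨?_, fun j _ => (h.norm_col j).trans h.opNorm_eq_one.symm, fun i j k => ?_⟩
  · simp [norm_ellOneOn, h.abs_alignedVec hσ]
  · rcases eq_or_ne i (p j) with hj | hj
    · rcases eq_or_ne i (p k) with hk | hk
      · have hterm {l : ι} (hl : i = p l) :
            col T l i * alignedVec T p σ l = σ i * |col T l i| ^ 2 / Fintype.card ι := by
          simp only [alignedVec, PiLp.toLp_apply, ← hl, sq_abs]
          ring
        rw [hterm hj, hterm hk, hj, h.abs_col_eq_one, ← hj, hk, h.abs_col_eq_one]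
        exact mul_self_nonneg _
      · simp [h.col_eq_zero k i hk]
    · simp [h.col_eq_zero j i hj]

theorem IsMonomial.col_mul_col_eq_zero_of_isUniformApprox (h : IsMonomial T p)
    (hA : IsUniformApprox ε T A) (hε : ε ≤ 1 / Fintype.card ι) {j k : ι} (hjk : p j ≠ p k) (i : κ) :
    col A j i * col A k i = 0 := by
  classical
  have : Nonempty ι := ⟨j⟩
  have hnonneg {σ : κ → ℝ} (hσ : ∀ i, |σ i| = 1) :
      0 ≤ (σ (p j) * σ (p k)) * ((col A j i * col A k i) * (col T j (p j) * col T k (p k))) := by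
    have hmem := hA.mem_normAttainSet (h.alignedVec_mem_normAttainSet hσ)
      fun l => hε.trans_eq (h.abs_alignedVec hσ l).symm
    have hno := ((mem_normAttainSet_iff A _).1 hmem).2.2 i j k
    simp only [alignedVec, PiLp.toLp_apply] at hno
    refine nonneg_of_mul_nonneg_left (b := (1 / (Fintype.card ι : ℝ)) ^ 2) ?_
      (pow_pos (one_div_pos.2 (Nat.cast_pos.2 Fintype.card_pos)) 2)
    exact hno.trans_eq (by ring)
  have hsame := hnonneg (σ := 1) (by simp)
  have hflip := hnonneg (σ := Function.update 1 (p j) (-1)) fun i => by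
    rcases eq_or_ne i (p j) with rfl | hi
    · simp
    · simp [hi]
  simp only [Pi.one_apply, mul_one, one_mul] at hsame
  simp only [Function.update_self, Function.update_of_ne hjk.symm, Pi.one_apply, mul_one, neg_mul,
    one_mul, Left.nonneg_neg_iff] at hflip
  refine (mul_eq_zero.1 (hflip.antisymm hsame)).resolve_right (abs_ne_zero.1 ?_)
  rw [abs_mul, h.abs_col_eq_one, h.abs_col_eq_one]
  norm_num

theorem abs_col_sub_col_le (T A : ellOneOn ι →L[ℝ] ellOneOn κ) (j : ι) (i : κ) :
    |col A j i - col T j i| ≤ ‖T - A‖ := by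
  rw [abs_sub_comm]
  exact (PiLp.norm_apply_le (col (T - A) j) i).trans (norm_col_le (T - A) j)

theorem IsMonomial.eq_of_norm_sub_lt_one (hT : IsMonomial T p) (hA : IsMonomial A p)
    (hTA : ‖T - A‖ < 1) : A = T := by
  suffices hcol : ∀ j, col A j = col T j by
    ext1 x
    simp_rw [apply_eq_sum_smul_col, hcol]
  intro j
  ext i
  rcases eq_or_ne i (p j) with rfl | hi
  · refine eq_of_abs_sub_lt_of_abs_eq ?_ ((hA.abs_col_eq_one j).trans (hT.abs_col_eq_one j).symm)
    exact (abs_col_sub_col_le T A j _).trans_lt (hTA.trans_eq (hT.abs_col_eq_one j).symm)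
  · rw [hA.col_eq_zero j i hi, hT.col_eq_zero j i hi]

theorem IsMonomial.of_isUniformApprox (hp : p.Surjective) (h : IsMonomial T p)
    (hA : IsUniformApprox ε T A) (hε : ε ≤ 1 / Fintype.card ι) (hTA : ‖T - A‖ < 1) :
    IsMonomial A p := by
  have hne (j : ι) : col A j (p j) ≠ 0 := by
    have hsign := sign_eq_of_abs_sub_lt <| (abs_col_sub_col_le T A j (p j)).trans_lt
      (hTA.trans_eq (h.abs_col_eq_one j).symm)
    rw [← sign_ne_zero, hsign, sign_ne_zero, ← abs_pos, h.abs_col_eq_one]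
    exact one_pos
  refine ⟨fun j => ?_, fun j i hi => ?_⟩
  · have : Nonempty ι := ⟨j⟩
    have habs := h.abs_alignedVec (σ := 1) (by simp)
    have hmem := hA.mem_normAttainSet (h.alignedVec_mem_normAttainSet (σ := 1) (by simp))
      fun l => hε.trans_eq (habs l).symm
    rw [← hA.2.1]
    refine ((mem_normAttainSet_iff A _).1 hmem).2.1 j (abs_pos.1 ?_)
    rw [habs]
    exact one_div_pos.2 (Nat.cast_pos.2 Fintype.card_pos)
  · obtain ⟨k, rfl⟩ := hp i
    have hmul := h.col_mul_col_eq_zero_of_isUniformApprox hA hε hi.symm (p k)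
    exact (mul_eq_zero.1 hmul).resolve_right (hne k)

theorem IsMonomial.isOnlyUniformApprox [Nonempty ι] (hp : p.Surjective) (h : IsMonomial T p)
    (hε : 0 < ε) (hει : ε ≤ 1 / Fintype.card ι) : IsOnlyUniformApprox ε T := by
  have hT := h.opNorm_eq_one
  refine fun A => ⟨fun hA => ?_, ?_⟩
  · obtain ⟨-, -, -, hTA⟩ := hA.exists_near (h.alignedVec_mem_normAttainSet (σ := 1) (by simp))
    have hε1 : ε ≤ 1 := hει.trans <| div_le_one_of_le₀
      (Nat.one_le_cast.2 Fintype.card_pos) (Nat.cast_nonneg _)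
    have hTA1 : ‖T - A‖ < 1 := hTA.trans_le hε1
    exact h.eq_of_norm_sub_lt_one (h.of_isUniformApprox hp hA hει hTA1) hTA1
  · rintro rfl
    exact isUniformApprox_of_normAttainSet_eq hT hT rfl (by rwa [sub_self, norm_zero])

theorem exists_forall_isOnlyUniformApprox_iff (hT : ‖T‖ = 1) :
    (∃ ε₀ : ℝ, 0 < ε₀ ∧ ∀ ε : ℝ, 0 < ε → ε < ε₀ → IsOnlyUniformApprox ε T) ↔
      ∃ p : ι → κ, p.Surjective ∧ IsMonomial T p := by
  constructor
  · rintro ⟨ε₀, hε₀, h⟩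
    exact exists_surjective_isMonomial hT
      (not_isNormPreservinglyApproximable_of_isOnlyUniformApprox hε₀ h)
  · rintro ⟨p, hp, h⟩
    have := nonempty_of_ne_zero (norm_pos_iff.1 (hT ▸ one_pos))
    exact ⟨1 / Fintype.card ι, one_div_pos.2 (Nat.cast_pos.2 Fintype.card_pos),
      fun ε hε hlt => h.isOnlyUniformApprox hp hε hlt.le⟩

end MonomialOperators

section Isometries

variable [Fintype ι] [Fintype κ] [DecidableEq ι] {T : ellOneOn ι →L[ℝ] ellOneOn κ} {p : ι → κ}

theorem isometry_iff_col :
    Isometry T ↔ (∀ j, ‖col T j‖ = 1) ∧ ∀ i j k, j ≠ k → col T j i * col T k i = 0 := by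
  rw [AddMonoidHomClass.isometry_iff_norm, ← forall_noCancellation_iff]
  have hsum (hone : ∀ j, ‖col T j‖ = 1) (x : ellOneOn ι) : ∑ j, ‖col T j‖ * |x j| = ‖x‖ := by
    simp only [hone, one_mul, norm_ellOneOn]
  constructor
  · intro h
    have hone (j : ι) : ‖col T j‖ = 1 := by
      rw [col, h, PiLp.norm_single, norm_one]
    exact ⟨hone, fun x => (norm_apply_eq_sum_norm_col_iff T x).1 ((h x).trans (hsum hone x).symm)⟩
  · rintro ⟨hone, hno⟩ x
    rw [(norm_apply_eq_sum_norm_col_iff T x).2 (hno x), hsum hone]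

theorem IsMonomial.isometry (h : IsMonomial T p) (hp : p.Injective) : Isometry T := by
  refine isometry_iff_col.2 ⟨h.norm_col, fun i j k hjk => ?_⟩
  rcases (hp.ne hjk).ne_or_ne i with hj | hk
  · rw [h.col_eq_zero j i hj.symm, zero_mul]
  · rw [h.col_eq_zero k i hk.symm, mul_zero]

theorem exists_bijective_isMonomial_of_isometry (hcard : Fintype.card κ ≤ Fintype.card ι)
    (hT : Isometry T) : ∃ p : ι → κ, p.Bijective ∧ IsMonomial T p := by
  obtain ⟨hone, hdisj⟩ := isometry_iff_col.1 hT
  choose p hp using fun j =>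
    exists_apply_ne_zero (norm_ne_zero_iff.1 ((hone j).trans_ne one_ne_zero))
  have hinj : p.Injective := fun j k hjk => by
    by_contra hne
    exact mul_ne_zero (hp j) (hjk ▸ hp k) (hdisj (p j) j k hne)
  have hbij : p.Bijective := (Fintype.bijective_iff_injective_and_card p).2
    ⟨hinj, (Fintype.card_le_of_injective p hinj).antisymm hcard⟩
  refine ⟨p, hbij, hone, fun j i hi => ?_⟩
  obtain ⟨k, rfl⟩ := hbij.2 i
  exact (mul_eq_zero.1 (hdisj (p k) j k (by rintro rfl; exact hi rfl))).resolve_right (hp k)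

theorem isometry_and_surjective_iff (hcard : Fintype.card ι ≤ Fintype.card κ) :
    Isometry T ∧ Function.Surjective T ↔ ∃ p : ι → κ, p.Surjective ∧ IsMonomial T p := by
  constructor
  · rintro ⟨hiso, hsurj⟩
    have hdim := LinearMap.finrank_le_finrank_of_surjective (f := T.toLinearMap) hsurj
    rw [finrank_ellOneOn, finrank_ellOneOn] at hdim
    obtain ⟨p, hp, h⟩ := exists_bijective_isMonomial_of_isometry hdim hiso
    exact ⟨p, hp.2, h⟩
  · rintro ⟨p, hp, h⟩
    have hp' := hp.bijective_of_nat_card_le (by simpa using hcard)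
    have hiso := h.isometry hp'.1
    refine ⟨hiso, (LinearMap.injective_iff_surjective_of_finrank_eq_finrank ?_).1 hiso.injective⟩
    rw [finrank_ellOneOn, finrank_ellOneOn, Fintype.card_of_bijective hp']

end Isometries

end BPB

theorem mainTheorem8_general {ι κ : Type*} [Fintype ι] [Fintype κ]
    (hcard : Fintype.card ι ≤ Fintype.card κ) :
    (∀ T : BPB.ellOneOn ι →L[ℝ] BPB.ellOneOn κ, ‖T‖ = 1 →
      (Isometry T ∧ Function.Surjective T ↔ ∃ ε₀ : ℝ, 0 < ε₀ ∧
        ∀ ε : ℝ, 0 < ε → ε < ε₀ → BPB.IsOnlyUniformApprox ε T)) ∧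
    BPB.HasNontrivialNormPreservingApprox (BPB.ellOneOn ι) (BPB.ellOneOn κ) := by
  classical
  refine ⟨fun T hT => ?_, fun T hT hiso => ?_⟩
  · rw [BPB.isometry_and_surjective_iff hcard, BPB.exists_forall_isOnlyUniformApprox_iff hT]
  · by_contra happ
    exact hiso ((BPB.isometry_and_surjective_iff hcard).2
      (BPB.exists_surjective_isMonomial hT happ)).1

theorem mainTheorem8 (n : ℕ) :
    (∀ T : BPB.ellOne n →L[ℝ] BPB.ellOne n, ‖T‖ = 1 →
      (Isometry T ↔ ∃ ε₀ : ℝ, 0 < ε₀ ∧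
        ∀ ε : ℝ, 0 < ε → ε < ε₀ → BPB.IsOnlyUniformApprox ε T)) ∧
    BPB.HasNontrivialNormPreservingApprox (BPB.ellOne n) (BPB.ellOne n) := by
  obtain ⟨hiff, happ⟩ := mainTheorem8_general (le_refl (Fintype.card (Fin n)))
  refine ⟨fun T hT => (and_iff_left_of_imp fun hiso => ?_).symm.trans (hiff T hT), happ⟩
  exact LinearMap.injective_iff_surjective.1 hiso.injective
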